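/- Let $R>1$. Put $$\Omega=\{x\le 0,\ 1<x^2+y^2<R^2\}\cup\{0\le x<R,\ |y|<R,\ x^2+y^2>1\}\subset\mathbb R^2,$$ $$\partial\Omega_I=\{x^2+y^2=1\},\qquad \partial\Omega_N=\{(R,y): -R<y<R\},$$ $$\partial\Omega_O=\{x\le 0,\ x^2+y^2=R^2\}\cup\{0\le x\le R,\ y=\pm R\}.$$ For $\varepsilon>0$, consider the bounded-domain Hemker problem $$-\varepsilon\Delta u+u_x=0\ \text{ in }\Omega,\qquad u=1\ \text{ on }\partial\Omega_I,\qquad u=0\ \text{ on }\partial\Omega_O,\qquad u_x=0\ \text{ on }\partial\Omega_N,$$ where a solution is a function $u\in C^0(\overline\Omega)\cap C^2(\Omega)$ satisfying these conditions ($u_x$ on $\partial\Omega_N$ being the one-sided derivative from inside $\Omega$). **Theorem 2.4.** There is $\varepsilon_0>0$ (depending only on $R$) such that for every $\mu>0$ there is a constant $C>0$ (depending only on $R$ and $\mu$, in particular not on $\varepsilon$) such that for every $0<\varepsilon\le\varepsilon_0$ the solution $u$ satisfies: 1. $0\le u(x,y)\le 1$ for all $(x,y)\in\overline\Omega$; 2.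 $u(r\cos\theta,r\sin\theta)\le C\,e^{\cos\theta\,(r-1)/\varepsilon}$ for all points $(r\cos\theta,r\sin\theta)\in\overline\Omega$ with $r\ge 1$ and $\cos\theta\le 0$; 3. $u(x,y)\le C\,e^{-(|y|-1)/\sqrt{\varepsilon}}$ for all $(x,y)\in\overline\Omega$ with $|y|\ge 1$ and $-R<x<R$; 4. $u(x,y)\le C\,e^{-(x^2/2+|y|-1)/(3\varepsilon^{2/3})}$ for all $(x,y)\in\overline\Omega$ with $|x|\le\varepsilon^{1/3}$ and $-\mu\,\varepsilon^{2/3}\le x^2/2+|y|-1\le\mu\,\varepsilon^{2/3}$. -/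

import Mathlib

namespace Hemker

/-- The (open) domain: the left half of the annulus `1 < r < R`, joined along `x = 0` to the
rectangle `[0, R) × (-R, R)` with the closed unit disk removed. -/
def domain (R : ℝ) : Set (ℝ × ℝ) :=
  {p | p.1 ≤ 0 ∧ 1 < p.1 ^ 2 + p.2 ^ 2 ∧ p.1 ^ 2 + p.2 ^ 2 < R ^ 2} ∪
  {p | 0 ≤ p.1 ∧ p.1 < R ∧ -R < p.2 ∧ p.2 < R ∧ 1 < p.1 ^ 2 + p.2 ^ 2}

/-- The inner boundary: the unit circle. -/
def innerBoundary : Set (ℝ × ℝ) :=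
  {p | p.1 ^ 2 + p.2 ^ 2 = 1}

/-- The outer Dirichlet boundary: the left half circle of radius `R` and the two horizontal
sides of the rectangle (corners included). -/
def outerBoundary (R : ℝ) : Set (ℝ × ℝ) :=
  {p | p.1 ≤ 0 ∧ p.1 ^ 2 + p.2 ^ 2 = R ^ 2} ∪
  {p | 0 ≤ p.1 ∧ p.1 ≤ R ∧ (p.2 = R ∨ p.2 = -R)}

/-- The partial derivative `u_x`. -/
noncomputable def partialX (u : ℝ × ℝ → ℝ) (p : ℝ × ℝ) : ℝ :=
  deriv (fun t : ℝ => u (t, p.2)) p.1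

/-- The Laplacian `u_xx + u_yy`. -/
noncomputable def laplacian (u : ℝ × ℝ → ℝ) (p : ℝ × ℝ) : ℝ :=
  iteratedDeriv 2 (fun t : ℝ => u (t, p.2)) p.1 +
  iteratedDeriv 2 (fun t : ℝ => u (p.1, t)) p.2

/-- `u` is a classical solution of the Hemker problem on the bounded domain: it is continuous on
the closed domain, twice continuously differentiable in the open domain, and satisfies the
equation and the boundary conditions. Only the values of `u` on the closed domain matter. -/
structure IsSolution (ε R : ℝ) (u : ℝ × ℝ → ℝ) : Prop where
  continuousOn : ContinuousOn u (closure (domain R))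
  contDiffOn : ContDiffOn ℝ 2 u (domain R)
  equation : ∀ p ∈ domain R, -ε * laplacian u p + partialX u p = 0
  inner : ∀ p ∈ innerBoundary, u p = 1
  outer : ∀ p ∈ outerBoundary R, u p = 0
  /-- `u_x = 0` on the outflow side `{R} × (-R, R)`; the derivative is taken from inside. -/
  neumann : ∀ y : ℝ, -R < y → y < R →
    HasDerivWithinAt (fun t : ℝ => u (t, y)) 0 (Set.Iic R) R

end Hemker

open Filter Topology Set

/-! Everything rests on a weak minimum principle for `-ε Δ + ∂ₓ` with mixed boundary conditions
(`Hemker.nonneg_of_supersolution`), localized to a closed set `S` so that a barrier need only work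
on part of the domain. `Hemker.IsSolution.le_of_supersolution` turns it into comparison with a
barrier that dominates `u` where `S` is cut off. The constants 0 and 1 give `0 ≤ u ≤ 1`. This bound
then controls `u` on the artificial boundaries: `x = 0` for the upstream exponential, `|y| = 1` for
the layer exponential. In the last estimate the exponent is bounded below in terms of `μ`, so `u ≤
1` and a large enough `C` suffice. -/

/-! ### One-variable calculus at a minimum -/

theorem iteratedDeriv_two_nonneg_of_isLocalMin {f : ℝ → ℝ} {x : ℝ} (hf : ContDiffAt ℝ 2 f x)
    (h : IsLocalMin f x) : 0 ≤ iteratedDeriv 2 f x := by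
  by_contra! hneg
  have h2 : iteratedDeriv 2 f x = deriv (deriv f) x := by
    rw [iteratedDeriv_succ, iteratedDeriv_one]
  rw [h2] at hneg
  -- A negative second derivative would make `x` a local maximum too, so `f` would be locally
  -- constant.
  have hmax : IsLocalMax f x :=
    isLocalMax_of_deriv_deriv_neg hneg h.deriv_eq_zero hf.continuousAt
  have hconst : f =ᶠ[𝓝 x] fun _ => f x := by
    filter_upwards [h, hmax] with t ht₁ ht₂ using le_antisymm ht₂ ht₁
  have : deriv (deriv f) x = 0 := by
    rw [hconst.deriv.deriv_eq]
    simp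
  linarith

theorem iteratedDeriv_two_eq {f f' : ℝ → ℝ} {x c : ℝ}
    (h : ∀ᶠ t in 𝓝 x, HasDerivAt f (f' t) t) (h' : HasDerivAt f' c x) :
    iteratedDeriv 2 f x = c := by
  have h2 : iteratedDeriv 2 f x = deriv (deriv f) x := by
    rw [iteratedDeriv_succ, iteratedDeriv_one]
  rw [h2]
  have : deriv f =ᶠ[𝓝 x] f' := h.mono fun t ht => ht.deriv
  rw [this.deriv_eq, h'.deriv]

theorem ContDiffAt.slice_fst {D : ℝ × ℝ → ℝ} {p : ℝ × ℝ} (h : ContDiffAt ℝ 2 D p) :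
    ContDiffAt ℝ 2 (fun t => D (t, p.2)) p.1 := by
  have : ContDiffAt ℝ 2 (fun t : ℝ => ((t, p.2) : ℝ × ℝ)) p.1 := by fun_prop
  exact ContDiffAt.comp p.1 (g := D) h this

theorem ContDiffAt.slice_snd {D : ℝ × ℝ → ℝ} {p : ℝ × ℝ} (h : ContDiffAt ℝ 2 D p) :
    ContDiffAt ℝ 2 (fun t => D (p.1, t)) p.2 := by
  have : ContDiffAt ℝ 2 (fun t : ℝ => ((p.1, t) : ℝ × ℝ)) p.2 := by fun_prop
  exact ContDiffAt.comp p.2 (g := D) h this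

theorem nonneg_of_isMinOn_Iic {f : ℝ → ℝ} {a b : ℝ} (h : HasDerivWithinAt f b (Iic a) a)
    (hmin : ∀ᶠ t in 𝓝[<] a, f a ≤ f t) : b ≤ 0 := by
  have h' : HasDerivWithinAt f b (Iio a) a := h.mono Iio_subset_Iic_self
  rw [hasDerivWithinAt_iff_tendsto_slope' (by simp)] at h'
  refine le_of_tendsto h' ?_
  filter_upwards [hmin, self_mem_nhdsWithin] with t ht hta
  rw [slope_def_field]
  exact div_nonpos_of_nonneg_of_nonpos (by linarith) (by simp at hta; linarith)

namespace Hemker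

/-! ### Geometry of the domain -/

theorem mem_of_mem_closure_domain {R : ℝ} {p : ℝ × ℝ} (hp : p ∈ closure (domain R)) :
    (p.1 ≤ 0 ∧ 1 ≤ p.1 ^ 2 + p.2 ^ 2 ∧ p.1 ^ 2 + p.2 ^ 2 ≤ R ^ 2) ∨
    (0 ≤ p.1 ∧ p.1 ≤ R ∧ -R ≤ p.2 ∧ p.2 ≤ R ∧ 1 ≤ p.1 ^ 2 + p.2 ^ 2) := by
  have hc : IsClosed
      (({p | p.1 ≤ 0} ∩ ({p | 1 ≤ p.1 ^ 2 + p.2 ^ 2} ∩ {p | p.1 ^ 2 + p.2 ^ 2 ≤ R ^ 2})) ∪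
      ({p : ℝ × ℝ | 0 ≤ p.1} ∩ ({p | p.1 ≤ R} ∩ ({p | -R ≤ p.2} ∩ ({p | p.2 ≤ R} ∩
        {p | 1 ≤ p.1 ^ 2 + p.2 ^ 2}))))) := by
    refine IsClosed.union ?_ ?_
    · exact (isClosed_le (by fun_prop) (by fun_prop)).inter
        ((isClosed_le (by fun_prop) (by fun_prop)).inter
          (isClosed_le (by fun_prop) (by fun_prop)))
    · exact (isClosed_le (by fun_prop) (by fun_prop)).inter
        ((isClosed_le (by fun_prop) (by fun_prop)).inter
          ((isClosed_le (by fun_prop) (by fun_prop)).inter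
            ((isClosed_le (by fun_prop) (by fun_prop)).inter
              (isClosed_le (by fun_prop) (by fun_prop)))))
  refine closure_minimal ?_ hc hp
  rintro q (⟨h1, h2, h3⟩ | ⟨h1, h2, h3, h4, h5⟩)
  · exact Or.inl ⟨h1, h2.le, h3.le⟩
  · exact Or.inr ⟨h1, h2.le, h3.le, h4.le, h5.le⟩

theorem bounds_of_mem_closure_domain {R : ℝ} (hR : 1 < R) {p : ℝ × ℝ}
    (hp : p ∈ closure (domain R)) : (-R ≤ p.1 ∧ p.1 ≤ R) ∧ (-R ≤ p.2 ∧ p.2 ≤ R) := by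
  rcases mem_of_mem_closure_domain hp with ⟨h1, h2, h3⟩ | ⟨h1, h2, h3, h4, h5⟩
  · exact ⟨abs_le.1 (abs_le_of_sq_le_sq (by nlinarith [sq_nonneg p.2]) (by linarith)),
      abs_le.1 (abs_le_of_sq_le_sq (by nlinarith [sq_nonneg p.1]) (by linarith))⟩
  · exact ⟨⟨by linarith, h2⟩, h3, h4⟩

theorem one_le_of_mem_closure_domain {R : ℝ} {p : ℝ × ℝ} (hp : p ∈ closure (domain R)) :
    1 ≤ p.1 ^ 2 + p.2 ^ 2 := by
  rcases mem_of_mem_closure_domain hp with ⟨h1, h2, h3⟩ | ⟨h1, h2, h3, h4, h5⟩ <;> assumption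

theorem isCompact_closure_domain {R : ℝ} (hR : 1 < R) : IsCompact (closure (domain R)) := by
  have hK : IsCompact (Icc (-R) R ×ˢ Icc (-R) R : Set (ℝ × ℝ)) := isCompact_Icc.prod isCompact_Icc
  refine hK.of_isClosed_subset isClosed_closure fun p hp => ?_
  exact bounds_of_mem_closure_domain hR hp

/-- The closed domain consists of the domain and the three parts of its boundary. -/
theorem closure_domain_cases {R : ℝ} {p : ℝ × ℝ} (hp : p ∈ closure (domain R)) :
    p ∈ innerBoundary ∨ p ∈ outerBoundary R ∨ p ∈ domain R ∨
      (p.1 = R ∧ -R < p.2 ∧ p.2 < R) := by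
  rcases (one_le_of_mem_closure_domain hp).eq_or_lt' with hr | hr
  · exact Or.inl hr
  right
  rcases mem_of_mem_closure_domain hp with ⟨h1, h2, h3⟩ | ⟨h1, h2, h3, h4, h5⟩
  · rcases h3.eq_or_lt with h | h
    · exact Or.inl (Or.inl ⟨h1, h⟩)
    · exact Or.inr (Or.inl (Or.inl ⟨h1, hr, h⟩))
  · rcases h3.eq_or_lt with h | h3
    · exact Or.inl (Or.inr ⟨h1, h2, Or.inr h.symm⟩)
    rcases h4.eq_or_lt with h | h4
    · exact Or.inl (Or.inr ⟨h1, h2, Or.inl h⟩)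
    rcases h2.eq_or_lt with h | h2
    · exact Or.inr (Or.inr ⟨h, h3, h4⟩)
    · exact Or.inr (Or.inl (Or.inr ⟨h1, h2, h3, h4, hr⟩))

theorem isOpen_domain {R : ℝ} (hR : 1 < R) : IsOpen (domain R) := by
  -- Neither defining piece is open along the seam `x = 0`; adding the full open disk of radius `R`
  -- covers the seam.
  have h : domain R = ({p | p.1 < 0} ∩ {p | p.1 ^ 2 + p.2 ^ 2 < R ^ 2} ∪
      {p | p.1 ^ 2 + p.2 ^ 2 < R ^ 2} ∪ {p | 0 < p.1} ∩ {p | p.1 < R} ∩ {p | -R < p.2} ∩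
        {p | p.2 < R}) ∩ {p : ℝ × ℝ | 1 < p.1 ^ 2 + p.2 ^ 2} := by
    ext p
    simp only [domain, mem_union, mem_inter_iff, mem_ofPred_eq]
    constructor
    · rintro (⟨h1, h2, h3⟩ | ⟨h1, h2, h3, h4, h5⟩)
      · exact ⟨Or.inl (Or.inr h3), h2⟩
      · rcases h1.eq_or_lt with h | h
        · refine ⟨Or.inl (Or.inr ?_), h5⟩
          rw [← h]
          nlinarith
        · exact ⟨Or.inr ⟨⟨⟨h, h2⟩, h3⟩, h4⟩, h5⟩
    · have key (h : p.1 ^ 2 + p.2 ^ 2 < R ^ 2) : p.1 < R ∧ -R < p.2 ∧ p.2 < R := by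
        have h1 := abs_lt.1 (abs_lt_of_sq_lt_sq
          (show p.1 ^ 2 < R ^ 2 by nlinarith [sq_nonneg p.2]) (by linarith))
        have h2 := abs_lt.1 (abs_lt_of_sq_lt_sq
          (show p.2 ^ 2 < R ^ 2 by nlinarith [sq_nonneg p.1]) (by linarith))
        exact ⟨h1.2, h2⟩
      rintro ⟨(⟨h1, h2⟩ | h1) | ⟨⟨⟨h1, h2⟩, h3⟩, h4⟩, h5⟩
      · exact Or.inl ⟨h1.le, h5, h2⟩
      · rcases le_total p.1 0 with h | h
        · exact Or.inl ⟨h, h5, h1⟩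
        · exact Or.inr ⟨h, (key h1).1, (key h1).2.1, (key h1).2.2, h5⟩
      · exact Or.inr ⟨h1.le, h2, h3, h4, h5⟩
  have o1 : IsOpen {p : ℝ × ℝ | p.1 ^ 2 + p.2 ^ 2 < R ^ 2} :=
    isOpen_lt (by fun_prop) (by fun_prop)
  rw [h]
  exact ((((isOpen_lt (by fun_prop) (by fun_prop)).inter o1).union o1).union
    ((((isOpen_lt (by fun_prop) (by fun_prop)).inter (isOpen_lt (by fun_prop) (by fun_prop))).inter
      (isOpen_lt (by fun_prop) (by fun_prop))).inter (isOpen_lt (by fun_prop) (by fun_prop)))).inter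
    (isOpen_lt (by fun_prop) (by fun_prop))

/-! ### Minimum and comparison principles -/

/-- The weak minimum principle for the mixed Dirichlet–Neumann problem, localized to a set `S`. -/
theorem nonneg_of_supersolution {ε R : ℝ} (hε : 0 < ε) (hR : 1 < R) {S : Set (ℝ × ℝ)}
    (hS : IsClosed S) {D : ℝ × ℝ → ℝ} (hD : ContinuousOn D (closure (domain R) ∩ S))
    (h : ∀ p ∈ closure (domain R) ∩ S, 0 ≤ D p ∨
      (p ∈ interior S ∧ p ∈ domain R ∧ ContDiffAt ℝ 2 D p ∧
        0 ≤ -ε * laplacian D p + partialX D p) ∨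
      (p ∈ interior S ∧ p.1 = R ∧ -R < p.2 ∧ p.2 < R ∧
        ∃ b, 0 ≤ b ∧ HasDerivWithinAt (fun t => D (t, p.2)) b (Iic R) R)) :
    ∀ p ∈ closure (domain R) ∩ S, 0 ≤ D p := by
  -- The term `δ (x + R)` is nonnegative on the closed domain and harmonic, with `x`-derivative `δ >
  -- 0`. It makes both the differential inequality and the outflow condition strict, which excludes
  -- minima there.
  have key : ∀ δ : ℝ, 0 < δ → ∀ q ∈ closure (domain R) ∩ S, 0 ≤ D q + δ * (q.1 + R) := by
    intro δ hδ q hq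
    have hcomp : IsCompact (closure (domain R) ∩ S) := (isCompact_closure_domain hR).inter_right hS
    obtain ⟨p, hp, hmin⟩ := hcomp.exists_isMinOn ⟨q, hq⟩
      (f := fun q => D q + δ * (q.1 + R)) (hD.add (by fun_prop))
    have hmin' : ∀ q ∈ closure (domain R) ∩ S, D p + δ * (p.1 + R) ≤ D q + δ * (q.1 + R) :=
      fun q hq => hmin hq
    refine le_trans ?_ (hmin' q hq)
    have hx : 0 ≤ p.1 + R := by linarith [(bounds_of_mem_closure_domain hR hp.1).1.1]
    rcases h p hp with h0 | ⟨hpS, hpd, hsm, hL⟩ | ⟨hpS, hpR, hy1, hy2, b, hb, hder⟩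
    · positivity
    · exfalso
      have hnear : ∀ᶠ q in 𝓝 p, D p + δ * (p.1 + R) ≤ D q + δ * (q.1 + R) := by
        filter_upwards [(isOpen_domain hR).mem_nhds hpd, mem_interior_iff_mem_nhds.1 hpS]
          with q h1 h2 using hmin' q ⟨subset_closure h1, h2⟩
      have hlx : IsLocalMin (fun t => D (t, p.2) + δ * (t + R)) p.1 :=
        (show ContinuousAt (fun t : ℝ => ((t, p.2) : ℝ × ℝ)) p.1 by fun_prop).eventually hnear
      have hly : IsLocalMin (fun t => D (p.1, t)) p.2 := by
        have := (show ContinuousAt (fun t : ℝ => ((p.1, t) : ℝ × ℝ)) p.2 by fun_prop).eventually hnear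
        filter_upwards [this] with t ht
        simpa using ht
      have hcx := hsm.slice_fst
      have hyy := iteratedDeriv_two_nonneg_of_isLocalMin hsm.slice_snd hly
      have hxx := iteratedDeriv_two_nonneg_of_isLocalMin
        (hcx.add (show ContDiffAt ℝ 2 (fun t : ℝ => δ * (t + R)) p.1 by fun_prop)) hlx
      have hlin (t : ℝ) : HasDerivAt (fun t : ℝ => δ * (t + R)) δ t := by
        simpa using ((hasDerivAt_id t).add_const R).const_mul δ
      have hlin2 : iteratedDeriv 2 (fun t : ℝ => δ * (t + R)) p.1 = 0 :=
        iteratedDeriv_two_eq (Eventually.of_forall hlin) (hasDerivAt_const _ _)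
      have hadd : iteratedDeriv 2 (fun t => D (t, p.2) + δ * (t + R)) p.1 =
          iteratedDeriv 2 (fun t => D (t, p.2)) p.1 := by
        rw [iteratedDeriv_fun_add hcx (by fun_prop), hlin2, add_zero]
      have hx0 := hlx.hasDerivAt_eq_zero
        ((hcx.differentiableAt (by norm_num)).hasDerivAt.add (hlin p.1))
      rw [hadd] at hxx
      have := mul_nonneg hε.le (add_nonneg hxx hyy)
      simp only [laplacian, partialX] at hL
      linarith
    · exfalso
      have hdom : ∀ᶠ t in 𝓝[<] R, (t, p.2) ∈ domain R := by
        have h1 : ∀ᶠ t in 𝓝[<] R, 1 < t := (eventually_gt_nhds hR).filter_mono nhdsWithin_le_nhds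
        filter_upwards [h1, self_mem_nhdsWithin] with t ht1 ht2
        exact Or.inr ⟨by simp; linarith, ht2, hy1, hy2, by simp; nlinarith [sq_nonneg p.2]⟩
      have hSn : ∀ᶠ t in 𝓝[<] R, (t, p.2) ∈ S := by
        have hc : ContinuousAt (fun t : ℝ => ((t, p.2) : ℝ × ℝ)) R := by fun_prop
        have : S ∈ 𝓝 ((R, p.2) : ℝ × ℝ) := by
          rw [← hpR]
          exact mem_interior_iff_mem_nhds.1 hpS
        exact (hc.eventually this).filter_mono nhdsWithin_le_nhds
      have hd := hder.add
        (((hasDerivAt_id R).add_const R).const_mul δ).hasDerivWithinAt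
      have := nonneg_of_isMinOn_Iic hd (by
        filter_upwards [hdom, hSn] with t h1 h2
        have := hmin' _ ⟨subset_closure h1, h2⟩
        have e : p = (R, p.2) := Prod.ext hpR rfl
        rw [e] at this
        simpa using this)
      linarith
  intro p hp
  by_contra! hneg
  have hx : 0 ≤ p.1 + R := by linarith [(bounds_of_mem_closure_domain hR hp.1).1.1]
  -- This `δ` keeps the perturbation at most `-D p / 2`, so the perturbed value would still be
  -- negative.
  have := key (-D p / (2 * (p.1 + R + 1))) (by apply div_pos <;> linarith) p hp
  have e : -D p / (2 * (p.1 + R + 1)) * (p.1 + R) ≤ -D p / 2 := by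
    rw [div_mul_eq_mul_div, div_le_div_iff₀ (by linarith) (by norm_num)]
    nlinarith
  linarith

/-- Comparison of a solution with a supersolution on the part of the domain inside `S`. -/
theorem IsSolution.le_of_supersolution {ε R : ℝ} (hε : 0 < ε) (hR : 1 < R) {u : ℝ × ℝ → ℝ}
    (hu : IsSolution ε R u) {S : Set (ℝ × ℝ)} (hS : IsClosed S) {B : ℝ × ℝ → ℝ}
    (hB : ∀ p ∈ closure (domain R) ∩ S, ContDiffAt ℝ 2 B p) (hB0 : ∀ p, 0 ≤ B p)
    (hfront : ∀ p ∈ closure (domain R) ∩ S, p ∈ interior S ∨ u p ≤ B p)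
    (hinner : ∀ p ∈ innerBoundary ∩ S, 1 ≤ B p)
    (hL : ∀ p ∈ domain R ∩ S, 0 ≤ -ε * laplacian B p + partialX B p)
    (hN : ∀ p ∈ S, p.1 = R → 0 ≤ partialX B p) :
    ∀ p ∈ closure (domain R) ∩ S, u p ≤ B p := by
  have := nonneg_of_supersolution (D := fun p => B p - u p) hε hR hS
    (ContinuousOn.sub (fun p hp => (hB p hp).continuousAt.continuousWithinAt)
      (hu.continuousOn.mono inter_subset_left)) ?_
  · exact fun p hp => sub_nonneg.1 (this p hp)
  intro p hp
  rcases hfront p hp with hpS | h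
  swap
  · exact Or.inl (sub_nonneg.2 h)
  rcases closure_domain_cases hp.1 with h | h | h | ⟨h1, h2, h3⟩
  · left
    rw [hu.inner p h]
    exact sub_nonneg.2 (hinner p ⟨h, hp.2⟩)
  · left
    rw [hu.outer p h]
    simpa using hB0 p
  · right; left
    have hup : ContDiffAt ℝ 2 u p := hu.contDiffOn.contDiffAt ((isOpen_domain hR).mem_nhds h)
    have hBp := hB p hp
    refine ⟨hpS, h, hBp.sub hup, ?_⟩
    have e1 := hu.equation p h
    have e2 := hL p ⟨h, hp.2⟩
    simp only [laplacian, partialX] at e1 e2 ⊢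
    rw [iteratedDeriv_fun_sub hBp.slice_fst hup.slice_fst,
      iteratedDeriv_fun_sub hBp.slice_snd hup.slice_snd,
      deriv_fun_sub (hBp.slice_fst.differentiableAt (by norm_num))
        (hup.slice_fst.differentiableAt (by norm_num))]
    linarith
  · right; right
    have hd := ((hB p hp).slice_fst.differentiableAt (by norm_num)).hasDerivAt
    have hb := hN p hp.2 h1
    simp only [partialX] at hb
    rw [h1] at hd hb
    refine ⟨hpS, h1, h2, h3, _, hb, ?_⟩
    exact (sub_zero (deriv (fun t => B (t, p.2)) R)) ▸
      hd.hasDerivWithinAt.sub (hu.neumann p.2 h2 h3)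

theorem laplacian_const (c : ℝ) (p : ℝ × ℝ) : laplacian (fun _ => c) p = 0 := by
  have h (x : ℝ) : iteratedDeriv 2 (fun _ : ℝ => c) x = 0 :=
    iteratedDeriv_two_eq (f' := fun _ => 0) (Eventually.of_forall fun t => hasDerivAt_const _ _)
      (hasDerivAt_const _ _)
  simp [laplacian, h]

theorem IsSolution.le_one {ε R : ℝ} (hε : 0 < ε) (hR : 1 < R) {u : ℝ × ℝ → ℝ}
    (hu : IsSolution ε R u) {p : ℝ × ℝ} (hp : p ∈ closure (domain R)) : u p ≤ 1 :=
  hu.le_of_supersolution hε hR (B := fun _ => 1) isClosed_univ (fun _ _ => contDiffAt_const)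
    (fun _ => zero_le_one) (fun p _ => Or.inl (by simp)) (fun _ _ => le_rfl)
    (fun p _ => by simp [laplacian_const, partialX]) (fun p _ _ => by simp [partialX])
    p ⟨hp, mem_univ p⟩

theorem IsSolution.nonneg {ε R : ℝ} (hε : 0 < ε) (hR : 1 < R) {u : ℝ × ℝ → ℝ}
    (hu : IsSolution ε R u) {p : ℝ × ℝ} (hp : p ∈ closure (domain R)) : 0 ≤ u p := by
  refine nonneg_of_supersolution hε hR isClosed_univ (hu.continuousOn.mono inter_subset_left)
    (fun q hq => ?_) p ⟨hp, mem_univ p⟩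
  rcases closure_domain_cases hq.1 with h | h | h | ⟨h1, h2, h3⟩
  · exact Or.inl (by rw [hu.inner q h]; exact zero_le_one)
  · exact Or.inl (hu.outer q h).ge
  · exact Or.inr (Or.inl ⟨by simp, h,
      hu.contDiffOn.contDiffAt ((isOpen_domain hR).mem_nhds h), (hu.equation q h).ge⟩)
  · exact Or.inr (Or.inr ⟨by simp, h1, h2, h3, 0, le_rfl, hu.neumann q.2 h2 h3⟩)

/-! ### Upstream barrier -/

theorem hasDerivAt_sqrt_add_sq {c x : ℝ} (h : 0 < x ^ 2 + c ^ 2) :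
    HasDerivAt (fun t => √(t ^ 2 + c ^ 2)) (x / √(x ^ 2 + c ^ 2)) x := by
  have := ((hasDerivAt_pow 2 x).add_const (c ^ 2)).sqrt h.ne'
  convert this using 1
  have : √(x ^ 2 + c ^ 2) ≠ 0 := (Real.sqrt_pos.2 h).ne'
  field_simp
  simp [mul_comm]

/-- The exponential barrier upstream of the disk: in polar coordinates it reads
`exp (cos θ * (r - 1) / ε)`. -/
noncomputable def upstreamBarrier (ε : ℝ) (p : ℝ × ℝ) : ℝ :=
  Real.exp ((p.1 - p.1 / √(p.1 ^ 2 + p.2 ^ 2)) / ε)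

theorem upstreamBarrier_hasDerivAt_fst (ε : ℝ) {x y : ℝ} (h : 0 < x ^ 2 + y ^ 2) :
    HasDerivAt (fun t => upstreamBarrier ε (t, y))
      (upstreamBarrier ε (x, y) * ((1 - y ^ 2 / √(x ^ 2 + y ^ 2) ^ 3) / ε)) x := by
  have hr : √(x ^ 2 + y ^ 2) ≠ 0 := (Real.sqrt_pos.2 h).ne'
  have hsq := Real.sq_sqrt h.le
  have := (((hasDerivAt_id x).sub
    ((hasDerivAt_id x).div (hasDerivAt_sqrt_add_sq h) hr)).div_const ε).exp
  convert this using 1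
  simp only [upstreamBarrier, id, Pi.sub_apply, Pi.div_apply]
  congr 2
  set r := √(x ^ 2 + y ^ 2)
  have hy : y ^ 2 = r ^ 2 - x ^ 2 := by linarith
  rw [hy, id]
  field_simp

theorem upstreamBarrier_hasDerivAt_snd (ε : ℝ) {x y : ℝ} (h : 0 < x ^ 2 + y ^ 2) :
    HasDerivAt (fun t => upstreamBarrier ε (x, t))
      (upstreamBarrier ε (x, y) * ((x * y / √(x ^ 2 + y ^ 2) ^ 3) / ε)) y := by
  have hr : √(x ^ 2 + y ^ 2) ≠ 0 := (Real.sqrt_pos.2 h).ne'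
  have hs : HasDerivAt (fun t => √(x ^ 2 + t ^ 2)) (y / √(x ^ 2 + y ^ 2)) y := by
    simpa only [add_comm] using hasDerivAt_sqrt_add_sq (c := x) (x := y) (by linarith)
  have := (((hasDerivAt_const y x).sub
    ((hasDerivAt_const y x).div hs hr)).div_const ε).exp
  convert this using 1
  simp only [upstreamBarrier, Pi.sub_apply, Pi.div_apply]
  congr 2
  field_simp
  ring

/-- For `exp (φ / ε)` the operator yields the factor `(φ_x - |∇φ|²) / ε - Δφ`. With `φ = x - x / r`
this is `y² (r - 1) / (ε r⁴) - x / r³`, and both terms are nonnegative for `r ≥ 1`, `x ≤ 0`. -/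
theorem upstreamBarrier_supersolution {ε : ℝ} (hε : 0 < ε) {x y : ℝ} (hx : x ≤ 0)
    (h : 1 ≤ x ^ 2 + y ^ 2) :
    0 ≤ -ε * laplacian (upstreamBarrier ε) (x, y) + partialX (upstreamBarrier ε) (x, y) := by
  have h0 : 0 < x ^ 2 + y ^ 2 := by linarith
  have hr : 0 < √(x ^ 2 + y ^ 2) := Real.sqrt_pos.2 h0
  have hr1 : 1 ≤ √(x ^ 2 + y ^ 2) := Real.one_le_sqrt.2 h
  have hsq := Real.sq_sqrt h0.le
  have hxx := iteratedDeriv_two_eq (x := x)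
    (((by fun_prop : ContinuousAt (fun t : ℝ => t ^ 2 + y ^ 2) x).eventually
      (eventually_gt_nhds h0)).mono fun t ht => upstreamBarrier_hasDerivAt_fst ε ht)
    ((upstreamBarrier_hasDerivAt_fst ε h0).mul
      ((((hasDerivAt_const x (y ^ 2)).div ((hasDerivAt_sqrt_add_sq h0).pow 3)
        (pow_ne_zero 3 hr.ne')).const_sub 1).div_const ε))
  have hs : HasDerivAt (fun t => √(x ^ 2 + t ^ 2)) (y / √(x ^ 2 + y ^ 2)) y := by
    simpa only [add_comm] using hasDerivAt_sqrt_add_sq (c := x) (x := y) (by linarith)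
  have hyy := iteratedDeriv_two_eq (x := y)
    (((by fun_prop : ContinuousAt (fun t : ℝ => x ^ 2 + t ^ 2) y).eventually
      (eventually_gt_nhds h0)).mono fun t ht => upstreamBarrier_hasDerivAt_snd ε ht)
    ((upstreamBarrier_hasDerivAt_snd ε h0).mul
      (((((hasDerivAt_id y).const_mul x).div (hs.pow 3)
        (pow_ne_zero 3 hr.ne'))).div_const ε))
  simp only [laplacian, partialX]
  rw [hxx, hyy, (upstreamBarrier_hasDerivAt_fst ε h0).deriv]
  have hpos : 0 < upstreamBarrier ε (x, y) := Real.exp_pos _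
  simp only [Pi.pow_apply, id]
  set r := √(x ^ 2 + y ^ 2)
  set E := upstreamBarrier ε (x, y)
  refine le_of_le_of_eq (b := E * (y ^ 2 * (r - 1) / (ε * r ^ 4) + -x / r ^ 3)) ?_ ?_
  · have : 0 ≤ r - 1 := by linarith
    have : 0 ≤ -x := by linarith
    positivity
  · have hy : y ^ 2 = r ^ 2 - x ^ 2 := by linarith
    have hy4 : y ^ 4 = (r ^ 2 - x ^ 2) ^ 2 := by rw [← hy]; ring
    push_cast
    field_simp
    ring_nf
    simp only [hy, hy4]
    ring

theorem upstreamBarrier_contDiffAt (ε : ℝ) {p : ℝ × ℝ} (h : 0 < p.1 ^ 2 + p.2 ^ 2) :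
    ContDiffAt ℝ 2 (upstreamBarrier ε) p := by
  have h1 : ContDiffAt ℝ 2 (fun p : ℝ × ℝ => √(p.1 ^ 2 + p.2 ^ 2)) p :=
    ContDiffAt.sqrt (by fun_prop) h.ne'
  exact ((contDiffAt_fst.sub (contDiffAt_fst.div h1 (Real.sqrt_pos.2 h).ne')).div_const ε).exp

theorem IsSolution.le_upstreamBarrier {ε R : ℝ} (hε : 0 < ε) (hR : 1 < R) {u : ℝ × ℝ → ℝ}
    (hu : IsSolution ε R u) {p : ℝ × ℝ} (hp : p ∈ closure (domain R)) (hx : p.1 ≤ 0) :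
    u p ≤ upstreamBarrier ε p := by
  refine hu.le_of_supersolution hε hR (S := {p | p.1 ≤ 0})
    (isClosed_le (by fun_prop) (by fun_prop))
    (fun q hq => upstreamBarrier_contDiffAt ε
      (by linarith [one_le_of_mem_closure_domain hq.1]))
    (fun _ => (Real.exp_pos _).le) (fun q hq => ?_) (fun q hq => ?_)
    (fun q hq => upstreamBarrier_supersolution hε hq.2
      (one_le_of_mem_closure_domain (subset_closure hq.1)))
    (fun q hq hqR => ?_) p ⟨hp, hx⟩
  · rcases (show q.1 ≤ 0 from hq.2).eq_or_lt with h | h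
    -- On the cut `x = 0` the barrier equals 1.
    · right
      simpa [upstreamBarrier, h] using hu.le_one hε hR hq.1
    · left
      exact interior_maximal (t := {p : ℝ × ℝ | p.1 < 0}) (fun z hz => (show z.1 < 0 from hz).le)
        (isOpen_lt (by fun_prop) (by fun_prop)) h
  · have : q.1 ^ 2 + q.2 ^ 2 = 1 := hq.1
    simp [upstreamBarrier, this]
  · have : q.1 ≤ 0 := hq
    linarith

/-! ### Parabolic layer barrier -/

/-- The barrier in the parabolic layers above (`s = 1`) and below (`s = -1`) the disk. -/
noncomputable def layerBarrier (ε R s : ℝ) (p : ℝ × ℝ) : ℝ :=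
  Real.exp (2 * (p.1 + R) - (s * p.2 - 1) / √ε)

theorem layerBarrier_hasDerivAt_fst (ε R s x y : ℝ) :
    HasDerivAt (fun t => layerBarrier ε R s (t, y)) (layerBarrier ε R s (x, y) * 2) x := by
  simpa [layerBarrier] using ((((hasDerivAt_id x).add_const R).const_mul 2).sub_const ((s * y - 1) / √ε)).exp

theorem layerBarrier_hasDerivAt_snd (ε R s x y : ℝ) :
    HasDerivAt (fun t => layerBarrier ε R s (x, t))
      (layerBarrier ε R s (x, y) * -(s / √ε)) y := by
  simpa [layerBarrier] using (((((hasDerivAt_id y).const_mul s).sub_const 1).div_const (√ε)).const_sub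
    (2 * (x + R))).exp

theorem layerBarrier_contDiff {ε R s : ℝ} : ContDiff ℝ 2 (layerBarrier ε R s) := by
  unfold layerBarrier
  fun_prop

/-- The operator multiplies the barrier by `2 - 4 ε - 1`, which is where `ε ≤ 1 / 4` comes from. -/
theorem layerBarrier_supersolution {ε s : ℝ} (hε : 0 < ε) (hε' : ε ≤ 1 / 4) (hs : s ^ 2 = 1)
    (R : ℝ) (p : ℝ × ℝ) :
    0 ≤ -ε * laplacian (layerBarrier ε R s) p + partialX (layerBarrier ε R s) p := by
  obtain ⟨x, y⟩ := p
  have hxx := iteratedDeriv_two_eq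
    (Eventually.of_forall fun t => layerBarrier_hasDerivAt_fst ε R s t y)
    ((layerBarrier_hasDerivAt_fst ε R s x y).mul_const 2)
  have hyy := iteratedDeriv_two_eq
    (Eventually.of_forall fun t => layerBarrier_hasDerivAt_snd ε R s x t)
    ((layerBarrier_hasDerivAt_snd ε R s x y).mul_const (-(s / √ε)))
  simp only [laplacian, partialX]
  rw [hxx, hyy, (layerBarrier_hasDerivAt_fst ε R s x y).deriv]
  have hpos : 0 < layerBarrier ε R s (x, y) := Real.exp_pos _
  have hq : ε * ((s / √ε) * (s / √ε)) = 1 := by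
    rw [div_mul_div_comm, ← sq, ← sq, hs, Real.sq_sqrt hε.le]
    field_simp
  generalize layerBarrier ε R s (x, y) = E at *
  have e : -ε * (E * 2 * 2 + E * -(s / √ε) * -(s / √ε)) + E * 2 =
      E * (2 - 4 * ε - ε * ((s / √ε) * (s / √ε))) := by ring
  rw [e, hq]
  exact mul_nonneg hpos.le (by linarith)

theorem IsSolution.le_layerBarrier {ε R s : ℝ} (hε : 0 < ε) (hε' : ε ≤ 1 / 4) (hR : 1 < R)
    (hs : s ^ 2 = 1) {u : ℝ × ℝ → ℝ} (hu : IsSolution ε R u) {p : ℝ × ℝ}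
    (hp : p ∈ closure (domain R)) (hy : 1 ≤ s * p.2) :
    u p ≤ layerBarrier ε R s p := by
  -- The shift by `R` makes the barrier at least 1 on the whole cut; the unit circle meets `S` only
  -- on that line.
  have hone (q : ℝ × ℝ) (hx : -R ≤ q.1) (hq : s * q.2 = 1) : 1 ≤ layerBarrier ε R s q := by
    simp only [layerBarrier, hq, sub_self, zero_div, sub_zero]
    exact Real.one_le_exp (by linarith)
  refine hu.le_of_supersolution hε hR (S := {p | 1 ≤ s * p.2})
    (isClosed_le (by fun_prop) (by fun_prop)) (B := layerBarrier ε R s)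
    (fun q _ => layerBarrier_contDiff.contDiffAt) (fun _ => (Real.exp_pos _).le)
    (fun q hq => ?_) (fun q hq => ?_) (fun q _ => layerBarrier_supersolution hε hε' hs R q)
    (fun q _ _ => ?_) p ⟨hp, hy⟩
  · rcases (show 1 ≤ s * q.2 from hq.2).eq_or_lt with h | h
    · right
      exact (hu.le_one hε hR hq.1).trans
        (hone q (bounds_of_mem_closure_domain hR hq.1).1.1 h.symm)
    · left
      exact interior_maximal (t := {p : ℝ × ℝ | 1 < s * p.2})
        (fun z hz => (show 1 < s * z.2 from hz).le)
        (isOpen_lt (by fun_prop) (by fun_prop)) h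
  · have h1 : q.1 ^ 2 + q.2 ^ 2 = 1 := hq.1
    have h2 : 1 ≤ s * q.2 := hq.2
    have h3 : (s * q.2) ^ 2 = q.2 ^ 2 := by rw [mul_pow, hs, one_mul]
    exact hone q (by nlinarith) (by nlinarith [sq_nonneg q.1])
  · rw [partialX]
    rw [(layerBarrier_hasDerivAt_fst ε R s q.1 q.2).deriv]
    exact mul_nonneg (Real.exp_pos _).le zero_le_two

end Hemker

/-! ### The four estimates -/

theorem theorem2p4 (R : ℝ) (hR : 1 < R) :
    ∃ ε₀ : ℝ, 0 < ε₀ ∧ ∀ μ : ℝ, 0 < μ → ∃ C : ℝ, 0 < C ∧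
      ∀ ε : ℝ, 0 < ε → ε ≤ ε₀ → ∀ u : ℝ × ℝ → ℝ, Hemker.IsSolution ε R u →
        (∀ p ∈ closure (Hemker.domain R), 0 ≤ u p ∧ u p ≤ 1) ∧
        (∀ r θ : ℝ, (r * Real.cos θ, r * Real.sin θ) ∈ closure (Hemker.domain R) →
          Real.cos θ ≤ 0 → 1 ≤ r →
          u (r * Real.cos θ, r * Real.sin θ) ≤ C * Real.exp (Real.cos θ * (r - 1) / ε)) ∧
        (∀ x y : ℝ, (x, y) ∈ closure (Hemker.domain R) → 1 ≤ |y| → -R < x → x < R →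
          u (x, y) ≤ C * Real.exp (-(|y| - 1) / Real.sqrt ε)) ∧
        (∀ x y : ℝ, (x, y) ∈ closure (Hemker.domain R) → |x| ≤ ε ^ (1 / 3 : ℝ) →
          -μ * ε ^ (2 / 3 : ℝ) ≤ x ^ 2 / 2 + |y| - 1 →
          x ^ 2 / 2 + |y| - 1 ≤ μ * ε ^ (2 / 3 : ℝ) →
          u (x, y) ≤ C * Real.exp (-(x ^ 2 / 2 + |y| - 1) / (3 * ε ^ (2 / 3 : ℝ)))) := by
  -- `exp (4 * R)` bounds the layer factor `exp (2 * (x + R))` for `x ≤ R`; `exp (μ / 3)`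
  -- compensates the smallest exponential in the last estimate.
  refine ⟨1 / 4, by norm_num, fun μ hμ => ⟨Real.exp (4 * R) + Real.exp (μ / 3), by positivity,
    fun ε hε hε' u hu => ?_⟩⟩
  have hC1 : 1 ≤ Real.exp (4 * R) + Real.exp (μ / 3) := by
    linarith [Real.one_le_exp (show 0 ≤ 4 * R by linarith), Real.exp_pos (μ / 3)]
  refine ⟨fun p hp => ⟨hu.nonneg hε hR hp, hu.le_one hε hR hp⟩, ?_, ?_, ?_⟩
  · intro r θ hp hθ hr
    have h := hu.le_upstreamBarrier hε hR hp (mul_nonpos_of_nonneg_of_nonpos (by linarith) hθ)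
    have hnorm : √((r * Real.cos θ) ^ 2 + (r * Real.sin θ) ^ 2) = r := by
      rw [show (r * Real.cos θ) ^ 2 + (r * Real.sin θ) ^ 2 = r ^ 2 by
        linear_combination r ^ 2 * Real.sin_sq_add_cos_sq θ]
      exact Real.sqrt_sq (by linarith)
    have he : r * Real.cos θ - r * Real.cos θ / r = Real.cos θ * (r - 1) := by
      have : r ≠ 0 := by linarith
      field_simp
    simp only [Hemker.upstreamBarrier, hnorm, he] at h
    exact h.trans (le_mul_of_one_le_left (Real.exp_pos _).le hC1)
  · intro x y hp hy _ hxR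
    obtain ⟨s, hs, hsy⟩ : ∃ s : ℝ, s ^ 2 = 1 ∧ s * y = |y| := by
      rcases abs_cases y with ⟨h, _⟩ | ⟨h, _⟩
      · exact ⟨1, by norm_num, by rw [h, one_mul]⟩
      · exact ⟨-1, by norm_num, by rw [h, neg_one_mul]⟩
    have h := hu.le_layerBarrier hε hε' hR hs hp (by rw [hsy]; exact hy)
    rw [Hemker.layerBarrier, hsy, sub_eq_add_neg, Real.exp_add, ← neg_div] at h
    refine h.trans (mul_le_mul_of_nonneg_right ?_ (Real.exp_pos _).le)
    have : Real.exp (2 * (x + R)) ≤ Real.exp (4 * R) := Real.exp_le_exp.2 (by linarith)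
    linarith [Real.exp_pos (μ / 3)]
  · intro x y hp _ _ hup
    have hpow : 0 < ε ^ (2 / 3 : ℝ) := Real.rpow_pos_of_pos hε _
    refine (hu.le_one hε hR hp).trans ?_
    calc (1 : ℝ) = Real.exp (μ / 3) * Real.exp (-(μ / 3)) := by rw [← Real.exp_add]; simp
      _ ≤ _ := by
        refine mul_le_mul (by linarith [Real.exp_pos (4 * R)]) (Real.exp_le_exp.2 ?_)
          (Real.exp_pos _).le (by positivity)
        rw [neg_div, neg_le_neg_iff, div_le_div_iff₀ (by positivity) (by norm_num)]
        linarith
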